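/- **Theorem (a Bayes' theorem for finite-dimensional $C^*$-algebras).** Let $X,Y$ be finite sets, let $m_x$ ($x\in X$) and $n_y$ ($y\in Y$) be positive integers, and put $$\mathcal A=\bigoplus_{x\in X}\mathcal M_{m_x}(\mathbb C),\qquad \mathcal B=\bigoplus_{y\in Y}\mathcal M_{n_y}(\mathbb C).$$ Let $F:\mathcal B\to\mathcal A$ be a completely positive unital (CPU) map, let $\omega:\mathcal A\to\mathbb C$ be a state, and let $\xi:=\omega\circ F$. Write $$\omega(A)=\sum_{x\in X}p_x\operatorname{tr}(\rho_xA_x),\qquad \xi(B)=\sum_{y\in Y}q_y\operatorname{tr}(\sigma_yB_y),$$ where $(p_x)$ and $(q_y)$ are probability measures on $X$ and $Y$, and every $\rho_x\in\mathcal M_{m_x}(\mathbb C)$ and every $\sigma_y\in\mathcal M_{n_y}(\mathbb C)$ is a density matrix (positive semidefinite of trace one). Let $F_{xy}:\mathcal M_{n_y}(\mathbb C)\to\mathcal M_{m_x}(\mathbb C)$ be the components of $F$, and let $F_{xy}^*$ be the Hilbert–Schmidt dual of $F_{xy}$, i.e. the linear map with $\operatorname{tr}(F_{xy}^*(A)B)=\operatorname{tr}(AF_{xy}(B))$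 for all $A,B$. Let $Q_y$ be the support of $\sigma_y$ (the orthogonal projection onto its range) and $Q_y^\perp=1-Q_y$. Write $\widehat{M}$ for the Moore–Penrose pseudoinverse of a matrix $M$, write $E^{(m)}_{ij}$ for the matrix units of $\mathcal M_m(\mathbb C)$, and write $\operatorname{tr}_{\mathcal M_{m}(\mathbb C)}:\mathcal M_m(\mathbb C)\otimes\mathcal M_n(\mathbb C)\to\mathcal M_n(\mathbb C)$ for the partial trace over the first factor. For $x\in X$ and $y\in Y$ with $q_y\neq0$ define the following elements of $\mathcal M_{m_x}(\mathbb C)\otimes\mathcal M_{n_y}(\mathbb C)$: $$\mathfrak A_{yx}:=\frac{p_x}{q_y}\sum_{i,j=1}^{m_x}E^{(m_x)}_{ij}\otimes\widehat{\sigma_y}\,F_{xy}^*\big(\rho_xE^{(m_x)}_{ij}\big)Q_y,\qquad \mathfrak B_{yx}:=\frac{p_x}{q_y}\sum_{i,j=1}^{m_x}E^{(m_x)}_{ij}\otimes\widehat{\sigma_y}\,F_{xy}^*\big(\rho_xE^{(m_x)}_{ij}\big)Q_y^\perp .$$ A *Bayesian inverse* of $(F,\omega)$ is a CPU map $G:\mathcal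 A\to\mathcal B$ such that $\xi(G(A)B)=\omega(AF(B))$ for all $A\in\mathcal A$, $B\in\mathcal B$. Then $(F,\omega)$ has a Bayesian inverse if and only if $$\mathfrak A_{yx}^\dagger=\mathfrak A_{yx}\qquad\text{for all }x\in X\text{ and all }y\in Y\text{ with }q_y\neq0,$$ and $$\sum_{x\in X}\operatorname{tr}_{\mathcal M_{m_x}(\mathbb C)}\!\big(\mathfrak B_{yx}^\dagger\,\widehat{\mathfrak A_{yx}}\,\mathfrak B_{yx}\big)\le Q_y^\perp\qquad\text{for all }y\in Y\text{ with }q_y\neq0 .$$ -/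

import Mathlib

open scoped CStarAlgebra MatrixOrder ComplexOrder Matrix.Norms.L2Operator Matrix Kronecker

namespace QBayes

/-- The finite-dimensional C⋆-algebra `⨁ x, M_{m x}(ℂ)`, with its componentwise operations
and involution, the positive semidefinite order and the (maximum of the) operator norm(s). -/
abbrev BlockAlg {X : Type*} (m : X → ℕ) : Type _ :=
  ∀ x, Matrix (Fin (m x)) (Fin (m x)) ℂ

/-- `G` is a Bayesian inverse of `(F, ω)`: a completely positive unital map `A → B` with
`ξ (G a * b) = ω (a * F b)` for all `a`, `b`, where `ξ := ω ∘ F`. -/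
structure IsBayesianInverse {A B : Type*} [CStarAlgebra A] [PartialOrder A] [StarOrderedRing A]
    [CStarAlgebra B] [PartialOrder B] [StarOrderedRing B]
    (F : B →CP A) (ω : A →ₚ[ℂ] ℂ) (G : A →CP B) : Prop where
  map_one : G 1 = 1
  bayes : ∀ (a : A) (b : B), ω (F (G a * b)) = ω (a * F b)

/-- A density matrix: positive semidefinite of trace one. -/
structure IsDensityMatrix {k : ℕ} (ρ : Matrix (Fin k) (Fin k) ℂ) : Prop where
  posSemidef : ρ.PosSemidef
  trace_eq_one : ρ.trace = 1

/-- The functional `φ` on `⨁ x, M_{m x}(ℂ)` is `φ(a) = ∑ x, p x * tr (ρ x * a x)`, where `p` is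
a probability measure on `X` and each `ρ x` is a density matrix. -/
structure IsBlockDecomposition {X : Type*} [Fintype X] {m : X → ℕ} (φ : BlockAlg m → ℂ)
    (p : X → ℝ) (ρ : BlockAlg m) : Prop where
  nonneg : ∀ x, 0 ≤ p x
  sum_eq_one : ∑ x, p x = 1
  density : ∀ x, IsDensityMatrix (ρ x)
  apply_eq : ∀ a : BlockAlg m, φ a = ∑ x, (p x : ℂ) * (ρ x * a x).trace

/-- The component `F_{xy} : M_{n y}(ℂ) → M_{m x}(ℂ)` of a linear map
`F : ⨁ y, M_{n y}(ℂ) → ⨁ x, M_{m x}(ℂ)`. -/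
def blockMap {X Y : Type*} [DecidableEq Y] {m : X → ℕ} {n : Y → ℕ}
    (F : BlockAlg n →ₗ[ℂ] BlockAlg m) (x : X) (y : Y) :
    Matrix (Fin (n y)) (Fin (n y)) ℂ →ₗ[ℂ] Matrix (Fin (m x)) (Fin (m x)) ℂ :=
  LinearMap.proj x ∘ₗ F ∘ₗ LinearMap.single ℂ (fun y => Matrix (Fin (n y)) (Fin (n y)) ℂ) y

/-- The Hilbert–Schmidt dual `f⋆` of a linear map `f` between matrix algebras; it is
characterized by `tr (f⋆(A) * B) = tr (A * f(B))`, see `trace_hsDual_mul`. -/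
def hsDual {k l : ℕ} (f : Matrix (Fin k) (Fin k) ℂ →ₗ[ℂ] Matrix (Fin l) (Fin l) ℂ) :
    Matrix (Fin l) (Fin l) ℂ →ₗ[ℂ] Matrix (Fin k) (Fin k) ℂ where
  toFun A := Matrix.of fun i j => (A * f (Matrix.single j i 1)).trace
  map_add' A B := by ext i j; simp [add_mul]
  map_smul' c A := by ext i j; simp

theorem trace_hsDual_mul {k l : ℕ}
    (f : Matrix (Fin k) (Fin k) ℂ →ₗ[ℂ] Matrix (Fin l) (Fin l) ℂ)
    (A : Matrix (Fin l) (Fin l) ℂ) (B : Matrix (Fin k) (Fin k) ℂ) :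
    (hsDual f A * B).trace = (A * f B).trace := by
  have hB : f B = ∑ i, ∑ j, B i j • f (Matrix.single i j 1) := by
    conv_lhs => rw [Matrix.matrix_eq_sum_single B]
    simp only [map_sum]
    refine Finset.sum_congr rfl fun i _ => Finset.sum_congr rfl fun j _ => ?_
    rw [← map_smul, Matrix.smul_single, smul_eq_mul, mul_one]
  rw [hB, Matrix.trace, Finset.mul_sum, Matrix.trace_sum]
  simp only [Finset.mul_sum, Matrix.trace_sum, Matrix.diag_apply, Matrix.mul_apply, hsDual,
    LinearMap.coe_mk, AddHom.coe_mk, Matrix.of_apply, Matrix.mul_smul, Matrix.trace_smul]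
  rw [Finset.sum_comm]
  refine Finset.sum_congr rfl fun i _ => Finset.sum_congr rfl fun j _ => ?_
  rw [smul_eq_mul, mul_comm]

section pinv

variable {ι : Type*} [Fintype ι] [DecidableEq ι]

/-- The (Moore–Penrose) pseudoinverse of a square matrix, as `(AᴴA)^ Aᴴ`, where the positive
semidefinite matrix `AᴴA` is pseudo-inverted by inverting its nonzero eigenvalues (recall that
`0⁻¹ = 0`). It is characterized by the four Penrose equations, see `pinv_spec`, `eq_pinv`. -/
noncomputable def pinv (A : Matrix ι ι ℂ) : Matrix ι ι ℂ :=
  cfc (fun t : ℝ => t⁻¹) (Aᴴ * A) * Aᴴ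

theorem pinv_spec (A : Matrix ι ι ℂ) :
    A * pinv A * A = A ∧ pinv A * A * pinv A = pinv A ∧
      (A * pinv A).IsHermitian ∧ (pinv A * A).IsHermitian := by
  set H := Aᴴ * A with hH
  have hsa : IsSelfAdjoint H := (Matrix.isHermitian_conjTranspose_mul_self A)
  set C := cfc (fun t : ℝ => t⁻¹) H with hC
  have hcont : ∀ g : ℝ → ℝ, ContinuousOn g (spectrum ℝ H) := fun g =>
    (Matrix.finite_real_spectrum (A := H)).continuousOn g
  have hCsa : Cᴴ = C := (cfc_predicate (fun t : ℝ => t⁻¹) H : IsSelfAdjoint C)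
  have hid : cfc (fun t : ℝ => t) H = H := cfc_id' ℝ H
  have hHC : H * C = C * H := by
    conv_lhs => rw [← hid]
    conv_rhs => rw [← hid]
    rw [hC, ← cfc_mul _ _ H (hcont _) (hcont _), ← cfc_mul _ _ H (hcont _) (hcont _)]
    simp only [mul_comm]
  have hHCH : H * C * H = H := by
    conv_lhs => rw [← hid]
    conv_rhs => rw [← hid]
    rw [hC, ← cfc_mul _ _ H (hcont _) (hcont _), ← cfc_mul _ _ H (hcont _) (hcont _)]
    simp only [mul_inv_mul_cancel]
  have hCHC : C * H * C = C := by
    conv_lhs => rw [← hid]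
    rw [hC, ← cfc_mul _ _ H (hcont _) (hcont _), ← cfc_mul _ _ H (hcont _) (hcont _)]
    congr 1
    funext t
    simpa using mul_inv_mul_cancel t⁻¹
  have hp : pinv A = C * Aᴴ := rfl
  have hAC : A * C * H = A := by
    rw [← sub_eq_zero, ← Matrix.conjTranspose_mul_self_eq_zero]
    have hHh : Hᴴ = H := hsa
    have : (A * C * H - A)ᴴ = H * C * Aᴴ - Aᴴ := by
      simp [Matrix.conjTranspose_mul, hCsa, hHh, mul_assoc]
    rw [this]
    calc (H * C * Aᴴ - Aᴴ) * (A * C * H - A)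
        = H * C * (Aᴴ * A) * C * H - H * C * (Aᴴ * A) - (Aᴴ * A) * C * H + Aᴴ * A := by
          noncomm_ring
      _ = 0 := by
          rw [← hH, hHCH, hHCH, sub_self, zero_sub, neg_add_cancel]
  refine ⟨?_, ?_, ?_, ?_⟩
  · rw [hp]; simpa [mul_assoc, hH] using hAC
  · rw [hp, mul_assoc C Aᴴ A, ← hH, ← mul_assoc, hCHC]
  · rw [hp]
    simp [Matrix.IsHermitian, Matrix.conjTranspose_mul, hCsa, mul_assoc]
  · have hHh : Hᴴ = H := hsa
    rw [hp, mul_assoc, ← hH, Matrix.IsHermitian, Matrix.conjTranspose_mul, hCsa, hHh, hHC]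

theorem eq_pinv {A B : Matrix ι ι ℂ} (h₁ : A * B * A = A) (h₂ : B * A * B = B)
    (h₃ : (A * B).IsHermitian) (h₄ : (B * A).IsHermitian) : B = pinv A := by
  obtain ⟨k₁, k₂, k₃, k₄⟩ := pinv_spec A
  set C := pinv A
  have e₁ : A * B = A * C := by
    calc A * B = (A * B)ᴴ := h₃.eq.symm
      _ = ((A * C) * (A * B))ᴴ := by rw [← mul_assoc, k₁]
      _ = (A * B) * (A * C) := by rw [Matrix.conjTranspose_mul, h₃.eq, k₃.eq]
      _ = A * C := by rw [← mul_assoc, h₁]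
  have e₂ : B * A = C * A := by
    calc B * A = (B * A)ᴴ := h₄.eq.symm
      _ = ((B * A) * (C * A))ᴴ := by rw [mul_assoc, ← mul_assoc A C A, k₁]
      _ = (C * A) * (B * A) := by rw [Matrix.conjTranspose_mul, h₄.eq, k₄.eq]
      _ = C * A := by rw [mul_assoc, ← mul_assoc A B A, h₁]
  calc B = B * A * B := h₂.symm
    _ = C * A * C := by rw [e₂, mul_assoc, e₁, ← mul_assoc]
    _ = C := k₂

/-- The support of a positive semidefinite matrix `A`: the matrix of the orthogonal projection
of `ℂ^ι` onto the range of `A`. It is the smallest projection `P` with `P * A = A`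
(equivalently `A * P = A`), see `support_spec`, and equals `A * pinv A`. -/
noncomputable def support (A : Matrix ι ι ℂ) : Matrix ι ι ℂ :=
  Matrix.toEuclideanLin.symm
    (LinearMap.range (Matrix.toEuclideanLin A)).starProjection.toLinearMap

theorem support_eq_mul_pinv (A : Matrix ι ι ℂ) : support A = A * pinv A := by
  obtain ⟨k₁, k₂, k₃, k₄⟩ := pinv_spec A
  have hmul : ∀ (M N : Matrix ι ι ℂ) (v : EuclideanSpace ℂ ι),
      Matrix.toEuclideanLin (M * N) v = Matrix.toEuclideanLin M (Matrix.toEuclideanLin N v) := by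
    intro M N v
    simp [Matrix.toLpLin_apply, Matrix.mulVec_mulVec]
  rw [support, LinearEquiv.symm_apply_eq]
  ext1 v
  refine Submodule.eq_starProjection_of_mem_of_inner_eq_zero ?_ ?_
  · rw [hmul]
    exact LinearMap.mem_range_self _ _
  · rintro _ ⟨u, rfl⟩
    rw [inner_sub_left, sub_eq_zero]
    have hadj : Matrix.toEuclideanLin (A * pinv A)
        = LinearMap.adjoint (Matrix.toEuclideanLin (A * pinv A)) := by
      rw [← Matrix.toEuclideanLin_conjTranspose_eq_adjoint, k₃.eq]
    rw [hadj, LinearMap.adjoint_inner_left, ← hmul, k₁]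

theorem support_spec (A : Matrix ι ι ℂ) :
    IsStarProjection (support A) ∧ support A * A = A ∧
      ∀ P : Matrix ι ι ℂ, IsStarProjection P → P * A = A → support A ≤ P := by
  obtain ⟨k₁, k₂, k₃, k₄⟩ := pinv_spec A
  have hs : IsStarProjection (support A) := by
    rw [support_eq_mul_pinv]
    exact ⟨by rw [IsIdempotentElem, ← mul_assoc, k₁], k₃⟩
  refine ⟨hs, by rw [support_eq_mul_pinv, k₁], fun P hP h => ?_⟩
  refine hs.le_of_mul_eq_right hP ?_
  rw [support_eq_mul_pinv, ← mul_assoc, h]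

end pinv

/-- The partial trace `M_k(ℂ) ⊗ M_l(ℂ) → M_l(ℂ)` over the first factor. -/
def partialTrace {k l : ℕ} (M : Matrix (Fin k × Fin l) (Fin k × Fin l) ℂ) :
    Matrix (Fin l) (Fin l) ℂ :=
  Matrix.of fun a b => ∑ i, M (i, a) (i, b)

theorem partialTrace_kronecker {k l : ℕ} (A : Matrix (Fin k) (Fin k) ℂ)
    (B : Matrix (Fin l) (Fin l) ℂ) : partialTrace (A ⊗ₖ B) = A.trace • B := by
  ext a b
  simp [partialTrace, Matrix.trace, Finset.sum_mul]

/-- `(p / q) ∑ i j, E i j ⊗ σ^ f⋆(ρ E i j) R`, for a linear map `f : M_l(ℂ) → M_k(ℂ)`. -/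
noncomputable def bayesChoi {k l : ℕ} (p q : ℝ)
    (f : Matrix (Fin l) (Fin l) ℂ →ₗ[ℂ] Matrix (Fin k) (Fin k) ℂ)
    (ρ : Matrix (Fin k) (Fin k) ℂ) (σ R : Matrix (Fin l) (Fin l) ℂ) :
    Matrix (Fin k × Fin l) (Fin k × Fin l) ℂ :=
  ((p / q : ℝ) : ℂ) • ∑ i, ∑ j,
    Matrix.single i j (1 : ℂ) ⊗ₖ (pinv σ * hsDual f (ρ * Matrix.single i j 1) * R)

/-- The matrix `𝔄_{yx} = (p_x / q_y) ∑ i j, E i j ⊗ σ_y^ F_{xy}⋆(ρ_x E i j) Q_y`, where `Q_y` is the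
support of `σ_y`. -/
noncomputable def matA {X Y : Type*} [DecidableEq Y] {m : X → ℕ} {n : Y → ℕ}
    (F : BlockAlg n →ₗ[ℂ] BlockAlg m) (p : X → ℝ) (ρ : BlockAlg m) (q : Y → ℝ) (σ : BlockAlg n)
    (y : Y) (x : X) : Matrix (Fin (m x) × Fin (n y)) (Fin (m x) × Fin (n y)) ℂ :=
  bayesChoi (p x) (q y) (blockMap F x y) (ρ x) (σ y) (support (σ y))

/-- The matrix `𝔅_{yx} = (p_x / q_y) ∑ i j, E i j ⊗ σ_y^ F_{xy}⋆(ρ_x E i j) (1 - Q_y)`, where `Q_y`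
is the support of `σ_y`. -/
noncomputable def matB {X Y : Type*} [DecidableEq Y] {m : X → ℕ} {n : Y → ℕ}
    (F : BlockAlg n →ₗ[ℂ] BlockAlg m) (p : X → ℝ) (ρ : BlockAlg m) (q : Y → ℝ) (σ : BlockAlg n)
    (y : Y) (x : X) : Matrix (Fin (m x) × Fin (n y)) (Fin (m x) × Fin (n y)) ℂ :=
  bayesChoi (p x) (q y) (blockMap F x y) (ρ x) (σ y) (1 - support (σ y))

end QBayes

open QBayes

/-! Testing the Bayes condition on single blocks turns it into `q_y σ_y G_yx(a) = p_x F_xy⋆(ρ_x a)`.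
For Choi matrices, with `C` that of `G_yx` and `K` that of `F_xy⋆`, this reads `q_y (1 ⊗ σ_y) C =
p_x (ρ_xᵀ ⊗ 1) K` (`bayes_iff_choi`). Complete positivity of `G` amounts to `C ≥ 0` for all pairs,
and unitality to `∑ x, tr₁ C = 1` for each `y`, so the problem splits over `y`.

Fix `y` with `q_y ≠ 0` and write `Q` also for `1 ⊗ Q_y`. Multiplying by the pseudoinverse of `σ_y`
shows that the Bayes condition prescribes `QC`: its two parts `QCQ` and `QC(1 - Q)` are `𝔄` and `𝔅`.
If `C ≥ 0`, then `𝔄` is Hermitian and `schur_complement_posSemidef` bounds the free corner `(1 -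
Q)C(1 - Q)` below by `𝔅ᴴ 𝔄^ 𝔅`. Taking partial traces and using unitality gives the inequality.

Conversely, a Hermitian `𝔄` is a product of two commuting positive matrices, hence positive, and the
range of `𝔅` lies in that of `𝔄` (`mul_pinv_mul_mul_eq`). Hence `𝔄 + 𝔅 + 𝔅ᴴ + 𝔅ᴴ 𝔄^ 𝔅` is positive
(`schur_extension_posSemidef`), and the inequality leaves a positive slack, added in the free corner
to restore unitality. The relation `ξ = ω ∘ F` forces the right-hand side of the Bayes condition to
vanish off `Q` (`smul_kronecker_mul_eq_zero`), so prescribing `QC` suffices. Blocks with `q_y = 0`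
impose nothing. -/

namespace QBayes

/-! ### Positive semidefinite matrices, pseudoinverses and Schur complements. -/

section LinearAlgebra

variable {ι : Type*} [Fintype ι] [DecidableEq ι]

theorem exists_eq_conjTranspose_mul_self {A : Matrix ι ι ℂ} (hA : A.PosSemidef) :
    ∃ U : Matrix ι ι ℂ, A = Uᴴ * U :=
  CStarAlgebra.nonneg_iff_eq_star_mul_self.mp hA.nonneg

theorem trace_mul_nonneg {A C : Matrix ι ι ℂ} (hA : A.PosSemidef) (hC : C.PosSemidef) :
    0 ≤ (A * C).trace := by
  obtain ⟨U, rfl⟩ := exists_eq_conjTranspose_mul_self hA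
  rw [mul_assoc, Matrix.trace_mul_comm]
  exact (hC.mul_mul_conjTranspose_same U).trace_nonneg

/-- With `A = UᴴU` and `C = VᴴV`, the trace is the squared Hilbert–Schmidt norm of `U Vᴴ`. -/
theorem mul_eq_zero_of_trace_mul_eq_zero {A C : Matrix ι ι ℂ} (hA : A.PosSemidef)
    (hC : C.PosSemidef) (h : (A * C).trace = 0) : A * C = 0 := by
  obtain ⟨U, rfl⟩ := exists_eq_conjTranspose_mul_self hA
  obtain ⟨V, rfl⟩ := exists_eq_conjTranspose_mul_self hC
  have h0 : U * Vᴴ = 0 := by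
    rw [← Matrix.trace_mul_conjTranspose_self_eq_zero_iff, ← h, mul_assoc Uᴴ U (Vᴴ * V),
      Matrix.trace_mul_comm Uᴴ]
    simp [mul_assoc]
  calc Uᴴ * U * (Vᴴ * V) = Uᴴ * (U * Vᴴ) * V := by noncomm_ring
    _ = 0 := by simp [h0]

theorem mul_eq_zero_of_conjTranspose_mul_mul_eq_zero {C M : Matrix ι ι ℂ}
    (hC : C.PosSemidef) (h : Mᴴ * C * M = 0) : C * M = 0 := by
  obtain ⟨V, rfl⟩ := exists_eq_conjTranspose_mul_self hC
  have h0 : V * M = 0 := by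
    rw [← Matrix.conjTranspose_mul_self_eq_zero, ← h, Matrix.conjTranspose_mul]
    simp only [Matrix.mul_assoc]
  rw [Matrix.mul_assoc, h0, Matrix.mul_zero]

/-- The adjoints of the four Penrose equations for `A` are again Penrose equations for `A`, so
uniqueness applies. -/
theorem pinv_isHermitian {A : Matrix ι ι ℂ} (hA : A.IsHermitian) : (pinv A).IsHermitian := by
  obtain ⟨k₁, k₂, k₃, k₄⟩ := pinv_spec A
  refine eq_pinv ?_ ?_ ?_ ?_
  · simpa [Matrix.conjTranspose_mul, hA.eq, mul_assoc] using congrArg Matrix.conjTranspose k₁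
  · simpa [Matrix.conjTranspose_mul, hA.eq, mul_assoc] using congrArg Matrix.conjTranspose k₂
  · simpa [Matrix.IsHermitian, Matrix.conjTranspose_mul, hA.eq] using k₄.eq.symm
  · simpa [Matrix.IsHermitian, Matrix.conjTranspose_mul, hA.eq] using k₃.eq.symm

theorem pinv_mul_comm {A : Matrix ι ι ℂ} (hA : A.IsHermitian) : pinv A * A = A * pinv A := by
  have h := (pinv_spec A).2.2.2.eq
  rwa [Matrix.conjTranspose_mul, hA.eq, (pinv_isHermitian hA).eq, eq_comm] at h

theorem pinv_posSemidef {A : Matrix ι ι ℂ} (hA : A.PosSemidef) : (pinv A).PosSemidef := by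
  have h := hA.conjTranspose_mul_mul_same (pinv A)
  rwa [(pinv_isHermitian hA.1).eq, (pinv_spec A).2.1] at h

/-- A range projection of a Hermitian matrix absorbs its pseudoinverse. -/
theorem mul_pinv_of_mul_eq {A Q : Matrix ι ι ℂ} (hA : A.IsHermitian) (h : Q * A = A) :
    Q * pinv A = pinv A := by
  have e : pinv A = A * (pinv A * pinv A) := by
    rw [← mul_assoc, ← pinv_mul_comm hA, (pinv_spec A).2.1]
  rw [e, ← mul_assoc, h]

theorem pinv_mul_of_mul_eq {A Q : Matrix ι ι ℂ} (hA : A.IsHermitian) (h : A * Q = A) :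
    pinv A * Q = pinv A := by
  have e : pinv A = pinv A * pinv A * A := by
    rw [mul_assoc, pinv_mul_comm hA, ← mul_assoc, (pinv_spec A).2.1]
  rw [e, mul_assoc, h]

section Schur

variable {C Q : Matrix ι ι ℂ}

/-- The generalized Schur complement of a compression of a positive semidefinite matrix. -/
theorem schur_complement_posSemidef (hC : C.PosSemidef) (hQ : Q.IsHermitian) (hQ2 : Q * Q = Q) :
    ((1 - Q) * C * (1 - Q) -
      (Q * C * (1 - Q))ᴴ * pinv (Q * C * Q) * (Q * C * (1 - Q))).PosSemidef := by
  set A := Q * C * Q with hAdef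
  set P := 1 - Q with hP
  have hPh : Pᴴ = P := by simp [hP, hQ.eq]
  clear_value P
  have hA : A.IsHermitian := by
    simp [hAdef, Matrix.IsHermitian, Matrix.conjTranspose_mul, hQ.eq, hC.1.eq, mul_assoc]
  have h1 : Q * pinv A = pinv A :=
    mul_pinv_of_mul_eq hA (by rw [hAdef]; simp only [← mul_assoc, hQ2])
  have h2 : pinv A * Q = pinv A := pinv_mul_of_mul_eq hA (by rw [hAdef]; simp only [mul_assoc, hQ2])
  have hB : (Q * C * P)ᴴ = P * C * Q := by
    simp [Matrix.conjTranspose_mul, hPh, hQ.eq, hC.1.eq, mul_assoc]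
  have e2 : pinv A * C * pinv A = pinv A := by
    have e : pinv A * A * pinv A = pinv A * Q * C * (Q * pinv A) := by
      rw [hAdef]; simp only [mul_assoc]
    rw [(pinv_spec A).2.1, h1, h2] at e
    exact e.symm
  set B := Q * C * P with hBdef
  have e3 : P * C * pinv A = Bᴴ * pinv A := by rw [hB, mul_assoc _ Q, h1]
  have e4 : pinv A * C * P = pinv A * B := by
    rw [hBdef, ← mul_assoc, ← mul_assoc, h2]
  have hZ : (P - pinv A * B)ᴴ = P - Bᴴ * pinv A := by
    rw [Matrix.conjTranspose_sub, Matrix.conjTranspose_mul, hPh, (pinv_isHermitian hA).eq]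
  -- Block Gaussian elimination: subtracting `pinv A * B` clears the off-diagonal part. All three
  -- correction terms equal `Bᴴ * pinv A * B` up to sign, thanks to `pinv A * C * pinv A = pinv A`.
  have h := hC.conjTranspose_mul_mul_same (P - pinv A * B)
  rw [hZ] at h
  convert h using 1
  have e5 : P * C * (pinv A * B) = Bᴴ * pinv A * B := by rw [← mul_assoc, e3]
  have e6 : Bᴴ * pinv A * C * P = Bᴴ * pinv A * B := by
    rw [mul_assoc, mul_assoc, ← mul_assoc (pinv A), e4, ← mul_assoc]
  have e7 : Bᴴ * pinv A * C * (pinv A * B) = Bᴴ * pinv A * B := by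
    rw [mul_assoc, mul_assoc, ← mul_assoc C, ← mul_assoc (pinv A), ← mul_assoc (pinv A), e2,
      ← mul_assoc]
  rw [mul_sub, sub_mul P, sub_mul (P * C), sub_mul (P * C), e5, e6, e7]
  abel

/-- The sum factors as `(Q + pinv A * B)ᴴ * A * (Q + pinv A * B)`; the range condition `hAB` is what
makes the cross terms come out as `B` and `Bᴴ`. -/
theorem schur_extension_posSemidef {A B : Matrix ι ι ℂ} (hA : A.PosSemidef)
    (hQ : Q.IsHermitian) (hQA : Q * A = A) (hQB : Q * B = B) (hAB : A * pinv A * B = B) :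
    (A + B + Bᴴ + Bᴴ * pinv A * B).PosSemidef := by
  have hAQ : A * Q = A := by
    simpa [Matrix.conjTranspose_mul, hA.1.eq, hQ.eq] using congrArg Matrix.conjTranspose hQA
  have hBQ : Bᴴ * Q = Bᴴ := by
    simpa [Matrix.conjTranspose_mul, hQ.eq] using congrArg Matrix.conjTranspose hQB
  have hp := (pinv_isHermitian hA.1).eq
  have hBA : Bᴴ * pinv A * A = Bᴴ := by
    simpa [Matrix.conjTranspose_mul, hp, hA.1.eq, mul_assoc] using congrArg Matrix.conjTranspose hAB
  have h := hA.conjTranspose_mul_mul_same (Q + pinv A * B)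
  convert h using 1
  rw [Matrix.conjTranspose_add, Matrix.conjTranspose_mul, hp, hQ.eq]
  calc A + B + Bᴴ + Bᴴ * pinv A * B
      = Q * A * Q + Q * (A * pinv A * B) + Bᴴ * pinv A * A * Q
          + Bᴴ * pinv A * A * pinv A * B := by rw [hAB, hBA, hQA, hAQ, hBQ, hQB]
    _ = _ := by noncomm_ring

end Schur

theorem sum_submatrix_posSemidef {S : Type*} [Fintype S] [DecidableEq S]
    {N : Matrix (ι × S) (ι × S) ℂ} (hN : N.PosSemidef) :
    (Matrix.of fun i j => ∑ s, ∑ t, N (i, s) (j, t)).PosSemidef := by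
  convert hN.conjTranspose_mul_mul_same
    (Matrix.of fun (a : ι × S) (i : ι) => if a.1 = i then (1 : ℂ) else 0) using 1
  ext i j
  simp only [Matrix.of_apply, Matrix.mul_apply, Fintype.sum_prod_type, Matrix.conjTranspose_apply,
    apply_ite, star_one, star_zero, ite_mul, one_mul, zero_mul, mul_one, mul_zero]
  rw [Finset.sum_comm, Finset.sum_eq_single j (fun x _ hx => by simp [hx]) (by simp)]
  refine Finset.sum_congr rfl fun t _ => ?_
  rw [if_pos rfl, Finset.sum_eq_single i (fun x _ hx => by simp [hx]) (by simp)]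
  simp

theorem commute_mul_posSemidef {A B : Matrix ι ι ℂ} (hA : A.PosSemidef) (hB : B.PosSemidef)
    (h : Commute A B) : (A * B).PosSemidef :=
  Matrix.nonneg_iff_posSemidef.mp (h.mul_nonneg hA.nonneg hB.nonneg)

end LinearAlgebra

/-! ### Choi matrices, Hilbert–Schmidt duals and partial traces. -/

section Choi

variable {k l : ℕ}

/-- The Choi matrix `∑ i j, E i j ⊗ f (E i j)` of a linear map `f : M_k(ℂ) → M_l(ℂ)`. -/
def choi (f : Matrix (Fin k) (Fin k) ℂ →ₗ[ℂ] Matrix (Fin l) (Fin l) ℂ) :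
    Matrix (Fin k × Fin l) (Fin k × Fin l) ℂ :=
  Matrix.of fun s t => f (Matrix.single s.1 t.1 1) s.2 t.2

/-- The linear map `M_k(ℂ) → M_l(ℂ)` with a given Choi matrix. -/
def ofChoi (C : Matrix (Fin k × Fin l) (Fin k × Fin l) ℂ) :
    Matrix (Fin k) (Fin k) ℂ →ₗ[ℂ] Matrix (Fin l) (Fin l) ℂ where
  toFun A := Matrix.of fun a b => ∑ s, ∑ t, A s t * C (s, a) (t, b)
  map_add' A B := by ext a b; simp [add_mul, Finset.sum_add_distrib]
  map_smul' c A := by ext a b; simp [Finset.mul_sum, mul_assoc]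

@[simp]
theorem choi_ofChoi (C : Matrix (Fin k × Fin l) (Fin k × Fin l) ℂ) : choi (ofChoi C) = C := by
  ext ⟨i, a⟩ ⟨j, b⟩
  simp [choi, ofChoi, Matrix.single_apply, ite_and]

theorem choi_injective {f g : Matrix (Fin k) (Fin k) ℂ →ₗ[ℂ] Matrix (Fin l) (Fin l) ℂ}
    (h : choi f = choi g) : f = g := by
  refine Matrix.ext_linearMap ℂ fun i j => LinearMap.ext_ring ?_
  ext a b
  exact congrFun (congrFun h (i, a)) (j, b)

theorem ofChoi_one (C : Matrix (Fin k × Fin l) (Fin k × Fin l) ℂ) :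
    ofChoi C 1 = partialTrace C := by
  ext a b
  simp [ofChoi, partialTrace, Matrix.one_apply]

theorem apply_one_eq_partialTrace
    (f : Matrix (Fin k) (Fin k) ℂ →ₗ[ℂ] Matrix (Fin l) (Fin l) ℂ) :
    f 1 = partialTrace (choi f) := by
  rw [← ofChoi_one, choi_injective (choi_ofChoi (choi f))]

theorem choi_smul (c : ℂ) (f : Matrix (Fin k) (Fin k) ℂ →ₗ[ℂ] Matrix (Fin l) (Fin l) ℂ) :
    choi (c • f) = c • choi f := rfl

theorem choi_mulLeft_comp (S : Matrix (Fin l) (Fin l) ℂ)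
    (f : Matrix (Fin k) (Fin k) ℂ →ₗ[ℂ] Matrix (Fin l) (Fin l) ℂ) :
    choi (LinearMap.mulLeft ℂ S ∘ₗ f) = ((1 : Matrix (Fin k) (Fin k) ℂ) ⊗ₖ S) * choi f := by
  ext ⟨i, a⟩ ⟨j, b⟩
  simp [choi, Matrix.mul_apply, Fintype.sum_prod_type, Matrix.one_apply]

theorem choi_mulRight_comp (S : Matrix (Fin l) (Fin l) ℂ)
    (f : Matrix (Fin k) (Fin k) ℂ →ₗ[ℂ] Matrix (Fin l) (Fin l) ℂ) :
    choi (LinearMap.mulRight ℂ S ∘ₗ f) = choi f * ((1 : Matrix (Fin k) (Fin k) ℂ) ⊗ₖ S) := by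
  ext ⟨i, a⟩ ⟨j, b⟩
  simp [choi, Matrix.mul_apply, Fintype.sum_prod_type, Matrix.one_apply]

/-- The transpose appears because `ρ * E i j = ∑ s, ρ s i • E s j`: the row index of `ρ` is summed
against the row index of the Choi matrix. -/
theorem choi_comp_mulLeft (ρ : Matrix (Fin k) (Fin k) ℂ)
    (f : Matrix (Fin k) (Fin k) ℂ →ₗ[ℂ] Matrix (Fin l) (Fin l) ℂ) :
    choi (f ∘ₗ LinearMap.mulLeft ℂ ρ) = (ρᵀ ⊗ₖ (1 : Matrix (Fin l) (Fin l) ℂ)) * choi f := by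
  ext ⟨i, a⟩ ⟨j, b⟩
  have h : ρ * Matrix.single i j 1 = ∑ s, ρ s i • Matrix.single s j (1 : ℂ) := by
    ext u v
    simp [Matrix.mul_apply, Matrix.sum_apply, Matrix.single_apply, ite_and]
  simp only [choi, LinearMap.comp_apply, LinearMap.mulLeft_apply, Matrix.of_apply, h, map_sum,
    map_smul]
  simp [Matrix.mul_apply, Matrix.sum_apply, Fintype.sum_prod_type, Matrix.one_apply]

/-- Swapping the tensor factors and transposing both preserve positivity, so duals of completely
positive maps have positive Choi matrices. -/
theorem choi_hsDual (f : Matrix (Fin k) (Fin k) ℂ →ₗ[ℂ] Matrix (Fin l) (Fin l) ℂ) :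
    choi (hsDual f) = ((choi f).submatrix Prod.swap Prod.swap)ᵀ := by
  ext ⟨i, a⟩ ⟨j, b⟩
  simp [choi, hsDual, Matrix.trace, Matrix.mul_apply, Matrix.single_apply, ite_and]

theorem choi_hsDual_posSemidef {f : Matrix (Fin k) (Fin k) ℂ →ₗ[ℂ] Matrix (Fin l) (Fin l) ℂ}
    (hf : (choi f).PosSemidef) : (choi (hsDual f)).PosSemidef := by
  rw [choi_hsDual]
  exact (hf.submatrix _).transpose

theorem sum_single_kronecker_eq_choi
    (f : Matrix (Fin k) (Fin k) ℂ →ₗ[ℂ] Matrix (Fin l) (Fin l) ℂ) :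
    ∑ i, ∑ j, Matrix.single i j (1 : ℂ) ⊗ₖ f (Matrix.single i j 1) = choi f := by
  ext ⟨i, a⟩ ⟨j, b⟩
  simp [choi, Matrix.sum_apply, Matrix.single_apply, ite_and]

theorem bayesChoi_eq (p q : ℝ) (f : Matrix (Fin l) (Fin l) ℂ →ₗ[ℂ] Matrix (Fin k) (Fin k) ℂ)
    (ρ : Matrix (Fin k) (Fin k) ℂ) (σ R : Matrix (Fin l) (Fin l) ℂ) :
    bayesChoi p q f ρ σ R = ((p / q : ℝ) : ℂ) • (((1 : Matrix (Fin k) (Fin k) ℂ) ⊗ₖ pinv σ) *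
      ((ρᵀ ⊗ₖ (1 : Matrix (Fin l) (Fin l) ℂ)) * choi (hsDual f)) *
      ((1 : Matrix (Fin k) (Fin k) ℂ) ⊗ₖ R)) := by
  rw [← choi_comp_mulLeft, ← choi_mulLeft_comp, ← choi_mulRight_comp,
    ← sum_single_kronecker_eq_choi]
  rfl

theorem partialTrace_add (M N : Matrix (Fin k × Fin l) (Fin k × Fin l) ℂ) :
    partialTrace (M + N) = partialTrace M + partialTrace N := by
  ext a b; simp [partialTrace, Finset.sum_add_distrib]

theorem partialTrace_sub (M N : Matrix (Fin k × Fin l) (Fin k × Fin l) ℂ) :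
    partialTrace (M - N) = partialTrace M - partialTrace N := by
  ext a b; simp [partialTrace]

theorem partialTrace_smul (c : ℂ) (M : Matrix (Fin k × Fin l) (Fin k × Fin l) ℂ) :
    partialTrace (c • M) = c • partialTrace M := by
  ext a b; simp [partialTrace, Finset.mul_sum]

theorem partialTrace_conjTranspose (M : Matrix (Fin k × Fin l) (Fin k × Fin l) ℂ) :
    partialTrace Mᴴ = (partialTrace M)ᴴ := by
  ext a b; simp [partialTrace]

theorem partialTrace_one_kronecker_mul (S : Matrix (Fin l) (Fin l) ℂ)
    (M : Matrix (Fin k × Fin l) (Fin k × Fin l) ℂ) :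
    partialTrace (((1 : Matrix (Fin k) (Fin k) ℂ) ⊗ₖ S) * M) = S * partialTrace M := by
  ext a b
  simp [partialTrace, Matrix.mul_apply, Fintype.sum_prod_type, Matrix.one_apply, Finset.mul_sum]
  rw [Finset.sum_comm]

theorem partialTrace_mul_one_kronecker (S : Matrix (Fin l) (Fin l) ℂ)
    (M : Matrix (Fin k × Fin l) (Fin k × Fin l) ℂ) :
    partialTrace (M * ((1 : Matrix (Fin k) (Fin k) ℂ) ⊗ₖ S)) = partialTrace M * S := by
  ext a b
  simp [partialTrace, Matrix.mul_apply, Fintype.sum_prod_type, Matrix.one_apply, Finset.sum_mul]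
  rw [Finset.sum_comm]

theorem trace_partialTrace (M : Matrix (Fin k × Fin l) (Fin k × Fin l) ℂ) :
    (partialTrace M).trace = M.trace := by
  simp only [Matrix.trace, partialTrace, Matrix.diag_apply, Matrix.of_apply, Fintype.sum_prod_type]
  rw [Finset.sum_comm]

theorem partialTrace_posSemidef {M : Matrix (Fin k × Fin l) (Fin k × Fin l) ℂ}
    (hM : M.PosSemidef) : (partialTrace M).PosSemidef := by
  have h : partialTrace M = ∑ i, M.submatrix (fun a => (i, a)) (fun a => (i, a)) := by
    ext a b; simp [partialTrace, Matrix.sum_apply]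
  rw [h]
  exact Matrix.posSemidef_sum _ fun i _ => hM.submatrix _

theorem conjTranspose_one_kronecker (S : Matrix (Fin l) (Fin l) ℂ) :
    ((1 : Matrix (Fin k) (Fin k) ℂ) ⊗ₖ S)ᴴ = (1 : Matrix (Fin k) (Fin k) ℂ) ⊗ₖ Sᴴ := by
  rw [Matrix.conjTranspose_kronecker, Matrix.conjTranspose_one]

theorem one_kronecker_mul_one_kronecker (S T : Matrix (Fin l) (Fin l) ℂ) :
    ((1 : Matrix (Fin k) (Fin k) ℂ) ⊗ₖ S) * ((1 : Matrix (Fin k) (Fin k) ℂ) ⊗ₖ T) =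
      (1 : Matrix (Fin k) (Fin k) ℂ) ⊗ₖ (S * T) := by
  rw [← Matrix.mul_kronecker_mul, one_mul]

end Choi

/-! ### Choi's theorem for block algebras. -/

section CompletePositivity

variable {X Y : Type*} {m : X → ℕ} {n : Y → ℕ} {k : ℕ}

/-- The `y`-component of a matrix over a block algebra, as a matrix of complex numbers. -/
def flatten (N : CStarMatrix (Fin k) (Fin k) (BlockAlg n)) (y : Y) :
    Matrix (Fin k × Fin (n y)) (Fin k × Fin (n y)) ℂ :=
  Matrix.of fun s t => N s.1 t.1 y s.2 t.2

theorem flatten_star_mul_self [Fintype Y] (S : CStarMatrix (Fin k) (Fin k) (BlockAlg n)) (y : Y) :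
    flatten (star S * S) y = (flatten S y)ᴴ * flatten S y := by
  ext ⟨i, a⟩ ⟨j, b⟩
  simp [flatten, CStarMatrix.mul_apply, CStarMatrix.star_apply, Matrix.mul_apply,
    Fintype.sum_prod_type, Matrix.sum_apply, Finset.sum_apply, Matrix.star_apply]

/-- Flattening sends `star S * S` to a Gram matrix in each block. Conversely, factors of the
flattened blocks reassemble into one `S`. -/
theorem nonneg_iff_flatten_posSemidef [Fintype Y] (N : CStarMatrix (Fin k) (Fin k) (BlockAlg n)) :
    0 ≤ N ↔ ∀ y, (flatten N y).PosSemidef := by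
  constructor
  · intro h
    rw [StarOrderedRing.nonneg_iff] at h
    induction h using AddSubmonoid.closure_induction with
    | mem N hN =>
      obtain ⟨S, rfl⟩ := hN
      intro y
      change (flatten (star S * S) y).PosSemidef
      rw [flatten_star_mul_self]
      exact Matrix.posSemidef_conjTranspose_mul_self _
    | zero => exact fun y => Matrix.PosSemidef.zero
    | add N N' _ _ h h' => exact fun y => (h y).add (h' y)
  · intro h
    choose W hW using fun y => exists_eq_conjTranspose_mul_self (h y)
    let S : CStarMatrix (Fin k) (Fin k) (BlockAlg n) :=
      CStarMatrix.ofMatrix (Matrix.of fun i j y => Matrix.of fun a b => W y (i, a) (j, b))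
    suffices hN : N = star S * S from hN ▸ star_mul_self_nonneg S
    have hS : ∀ y, flatten N y = flatten (star S * S) y := fun y => by
      rw [flatten_star_mul_self, hW y]; rfl
    ext i j y a b
    exact congrFun (congrFun (hS y) (i, a)) (j, b)

/-- Choi's argument: `F` is applied entrywise to the matrix of matrix units of block `y`. This is
positive, since its flattening is the rank-one matrix of `∑ i, e_i ⊗ e_i` in block `y` and zero in
the others. -/
theorem choi_blockMap_posSemidef [Fintype X] [Fintype Y] [DecidableEq Y]
    (F : BlockAlg n →CP BlockAlg m) (x : X) (y : Y) :
    (choi (blockMap F.toLinearMap x y)).PosSemidef := by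
  let M : CStarMatrix (Fin (n y)) (Fin (n y)) (BlockAlg n) :=
    CStarMatrix.ofMatrix (Matrix.of fun i j => Pi.single y (Matrix.single i j 1))
  have hM : 0 ≤ M := by
    rw [nonneg_iff_flatten_posSemidef]
    intro z
    by_cases hz : z = y
    · subst hz
      convert Matrix.posSemidef_vecMulVec_self_star
        (fun s : Fin (n z) × Fin (n z) => if s.1 = s.2 then (1 : ℂ) else 0) using 1
      ext ⟨i, a⟩ ⟨j, b⟩
      by_cases h1 : i = a <;> by_cases h2 : j = b <;>
        simp [flatten, M, Matrix.single_apply, Matrix.vecMulVec_apply, h1, h2]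
    · convert Matrix.PosSemidef.zero using 1
      ext ⟨i, a⟩ ⟨j, b⟩
      simp [flatten, M, hz]
  exact (nonneg_iff_flatten_posSemidef _).mp (F.map_cstarMatrix_nonneg' _ M hM) x

/-- The linear map between block algebras whose components have the Choi matrices `C y x`. -/
def blockOfChoi [Fintype X]
    (C : ∀ (y : Y) (x : X), Matrix (Fin (m x) × Fin (n y)) (Fin (m x) × Fin (n y)) ℂ) :
    BlockAlg m →ₗ[ℂ] BlockAlg n :=
  LinearMap.pi fun y => ∑ x, ofChoi (C y x) ∘ₗ LinearMap.proj x

theorem blockOfChoi_apply [Fintype X]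
    (C : ∀ (y : Y) (x : X), Matrix (Fin (m x) × Fin (n y)) (Fin (m x) × Fin (n y)) ℂ)
    (a : BlockAlg m) (y : Y) : blockOfChoi C a y = ∑ x, ofChoi (C y x) (a x) := by
  simp [blockOfChoi]

/-- A linear map with positive semidefinite Choi matrices is completely positive. -/
def cpOfChoi [Fintype X] [Fintype Y]
    (C : ∀ (y : Y) (x : X), Matrix (Fin (m x) × Fin (n y)) (Fin (m x) × Fin (n y)) ℂ)
    (hC : ∀ y x, (C y x).PosSemidef) : BlockAlg m →CP BlockAlg n where
  toLinearMap := blockOfChoi C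
  map_cstarMatrix_nonneg' k M hM := by
    rw [nonneg_iff_flatten_posSemidef] at hM ⊢
    intro y
    -- The image is a sum over `x` of contractions of `flatten M x ⊗ₖ C y x` along the `Fin (m x)`
    -- indices, and such a contraction is a compression.
    have h : flatten (M.map (blockOfChoi C)) y = ∑ x, Matrix.of fun i j => ∑ s, ∑ t,
        ((flatten M x ⊗ₖ C y x).submatrix
          (fun u : (Fin k × Fin (n y)) × Fin (m x) => ((u.1.1, u.2), (u.2, u.1.2)))
          (fun u => ((u.1.1, u.2), (u.2, u.1.2)))) (i, s) (j, t) := by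
      ext ⟨i, a⟩ ⟨j, b⟩
      simp [flatten, blockOfChoi_apply, Matrix.sum_apply, ofChoi]
    rw [h]
    exact Matrix.posSemidef_sum _ fun x _ =>
      sum_submatrix_posSemidef (((hM x).kronecker (hC y x)).submatrix _)

end CompletePositivity

/-! ### Support projections. -/

section Support

variable {ι : Type*} [Fintype ι] [DecidableEq ι]

theorem support_isHermitian (A : Matrix ι ι ℂ) : (support A).IsHermitian :=
  (support_spec A).1.isSelfAdjoint

theorem support_mul_support (A : Matrix ι ι ℂ) : support A * support A = support A :=
  (support_spec A).1.isIdempotentElem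

theorem support_mul_self (A : Matrix ι ι ℂ) : support A * A = A :=
  (support_spec A).2.1

theorem self_mul_support {A : Matrix ι ι ℂ} (hA : A.IsHermitian) : A * support A = A := by
  simpa [Matrix.conjTranspose_mul, hA.eq, (support_isHermitian A).eq] using
    congrArg Matrix.conjTranspose (support_mul_self A)

theorem pinv_mul_self {A : Matrix ι ι ℂ} (hA : A.IsHermitian) : pinv A * A = support A := by
  rw [support_eq_mul_pinv, pinv_mul_comm hA]

theorem one_sub_support_posSemidef (A : Matrix ι ι ℂ) : (1 - support A).PosSemidef :=
  Matrix.nonneg_iff_posSemidef.mp (support_spec A).1.one_sub.nonneg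

end Support

/-! ### The Bayes condition in blocks and in Choi form. -/

section Blocks

variable {X Y : Type*} [Fintype X] [Fintype Y] [DecidableEq Y] {m : X → ℕ} {n : Y → ℕ}

omit [Fintype X] in
theorem apply_eq_sum_blockMap (F : BlockAlg n →ₗ[ℂ] BlockAlg m) (b : BlockAlg n) (x : X) :
    F b x = ∑ y, blockMap F x y (b y) := by
  conv_lhs => rw [← Finset.univ_sum_single b]
  simp [blockMap]

/-- This is `ξ = ω ∘ F` tested on elements of block `y`; it is the only link tying `σ y` to `F` and
`ρ`. -/
theorem sum_smul_hsDual_eq {F : BlockAlg n →CP BlockAlg m} {ω : BlockAlg m →ₚ[ℂ] ℂ}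
    {p : X → ℝ} {ρ : BlockAlg m} (hpρ : IsBlockDecomposition (fun a => ω a) p ρ)
    {q : Y → ℝ} {σ : BlockAlg n} (hqσ : IsBlockDecomposition (fun b => ω (F b)) q σ) (y : Y) :
    ∑ x, (p x : ℂ) • hsDual (blockMap F.toLinearMap x y) (ρ x) = (q y : ℂ) • σ y := by
  refine Matrix.ext_iff_trace_mul_right.mpr fun b => ?_
  have h1 := hpρ.apply_eq (F (Pi.single y b))
  have h2 := hqσ.apply_eq (Pi.single y b)
  rw [h1, Finset.sum_eq_single y (fun z _ hz => by simp [hz]) (by simp)] at h2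
  simp only [Finset.sum_mul, Matrix.trace_sum, Matrix.smul_mul, Matrix.trace_smul,
    trace_hsDual_mul, smul_eq_mul]
  rw [Pi.single_eq_same] at h2
  exact h2

/-- Both sides are sums of trace pairings over `(x, y)`. Elements supported in one block isolate a
summand, and the trace pairing is nondegenerate. -/
theorem bayes_iff [DecidableEq X] {F : BlockAlg n →CP BlockAlg m} {ω : BlockAlg m →ₚ[ℂ] ℂ}
    {p : X → ℝ} {ρ : BlockAlg m} (hpρ : IsBlockDecomposition (fun a => ω a) p ρ)
    {q : Y → ℝ} {σ : BlockAlg n} (hqσ : IsBlockDecomposition (fun b => ω (F b)) q σ)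
    (G : BlockAlg m →CP BlockAlg n) :
    (∀ a b, ω (F (G a * b)) = ω (a * F b)) ↔ ∀ x y a,
      (q y : ℂ) • (σ y * blockMap G.toLinearMap y x a) =
        (p x : ℂ) • hsDual (blockMap F.toLinearMap x y) (ρ x * a) := by
  have hω : ∀ a b, ω (a * F b) = ∑ x, ∑ y,
      (p x : ℂ) * (hsDual (blockMap F.toLinearMap x y) (ρ x * a x) * b y).trace := fun a b => by
    refine (hpρ.apply_eq (a * F b)).trans (Finset.sum_congr rfl fun x _ => ?_)
    have h : F b x = ∑ y, blockMap F.toLinearMap x y (b y) :=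
      apply_eq_sum_blockMap F.toLinearMap b x
    rw [Pi.mul_apply, h, ← mul_assoc, Finset.mul_sum, Matrix.trace_sum, Finset.mul_sum]
    simp only [trace_hsDual_mul]
  have hξ : ∀ a b, ω (F (G a * b)) = ∑ x, ∑ y,
      (q y : ℂ) * (σ y * blockMap G.toLinearMap y x (a x) * b y).trace := fun a b => by
    rw [Finset.sum_comm]
    refine (hqσ.apply_eq (G a * b)).trans (Finset.sum_congr rfl fun y _ => ?_)
    have h : G a y = ∑ x, blockMap G.toLinearMap y x (a x) :=
      apply_eq_sum_blockMap G.toLinearMap a y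
    rw [Pi.mul_apply, h, ← mul_assoc, Finset.mul_sum, Finset.sum_mul, Matrix.trace_sum,
      Finset.mul_sum]
  constructor
  · intro h x y a
    refine Matrix.ext_iff_trace_mul_right.mpr fun b => ?_
    have h1 := h (Pi.single x a) (Pi.single y b)
    rw [hω, hξ] at h1
    rw [Finset.sum_eq_single x (fun z _ hz => by simp [hz]) (by simp),
      Finset.sum_eq_single x (fun z _ hz => by simp [hz]) (by simp),
      Finset.sum_eq_single y (fun z _ hz => by simp [hz]) (by simp),
      Finset.sum_eq_single y (fun z _ hz => by simp [hz]) (by simp),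
      Pi.single_eq_same, Pi.single_eq_same] at h1
    simpa using h1
  · intro h a b
    rw [hω, hξ]
    refine Finset.sum_congr rfl fun x _ => Finset.sum_congr rfl fun y _ => ?_
    simpa using congrArg (fun M => (M * b y).trace) (h x y (a x))

theorem bayes_iff_choi [DecidableEq X] {F : BlockAlg n →CP BlockAlg m} {ω : BlockAlg m →ₚ[ℂ] ℂ}
    {p : X → ℝ} {ρ : BlockAlg m} (hpρ : IsBlockDecomposition (fun a => ω a) p ρ)
    {q : Y → ℝ} {σ : BlockAlg n} (hqσ : IsBlockDecomposition (fun b => ω (F b)) q σ)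
    (G : BlockAlg m →CP BlockAlg n) :
    (∀ a b, ω (F (G a * b)) = ω (a * F b)) ↔ ∀ x y,
      (q y : ℂ) • (((1 : Matrix (Fin (m x)) (Fin (m x)) ℂ) ⊗ₖ σ y) *
          choi (blockMap G.toLinearMap y x)) =
        (p x : ℂ) • (((ρ x)ᵀ ⊗ₖ (1 : Matrix (Fin (n y)) (Fin (n y)) ℂ)) *
          choi (hsDual (blockMap F.toLinearMap x y))) := by
  rw [bayes_iff hpρ hqσ]
  refine forall₂_congr fun x y => ?_
  rw [← choi_mulLeft_comp, ← choi_comp_mulLeft, ← choi_smul, ← choi_smul]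
  exact ⟨fun h => congrArg choi (LinearMap.ext h), fun h a =>
    LinearMap.congr_fun (choi_injective h) a⟩

theorem hsDual_apply_eq_partialTrace {k l : ℕ}
    (f : Matrix (Fin l) (Fin l) ℂ →ₗ[ℂ] Matrix (Fin k) (Fin k) ℂ)
    (ρ : Matrix (Fin k) (Fin k) ℂ) :
    hsDual f ρ = partialTrace ((ρᵀ ⊗ₖ (1 : Matrix (Fin l) (Fin l) ℂ)) * choi (hsDual f)) := by
  rw [← choi_comp_mulLeft, ← apply_one_eq_partialTrace]
  simp

/-- A projection orthogonal to the marginal `∑ x, p x • tr (ρ xᵀ K x)` kills each summand. -/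
theorem smul_kronecker_mul_eq_zero {l : ℕ} {p : X → ℝ} (hp : ∀ x, 0 ≤ p x) {ρ : BlockAlg m}
    (hρ : ∀ x, (ρ x).PosSemidef)
    {K : ∀ x, Matrix (Fin (m x) × Fin l) (Fin (m x) × Fin l) ℂ} (hK : ∀ x, (K x).PosSemidef)
    {P : Matrix (Fin l) (Fin l) ℂ} (hP : P.PosSemidef)
    (h : P * ∑ x, (p x : ℂ) • partialTrace (((ρ x)ᵀ ⊗ₖ (1 : Matrix (Fin l) (Fin l) ℂ)) * K x) = 0)
    (x : X) :
    (p x : ℂ) • (((1 : Matrix (Fin (m x)) (Fin (m x)) ℂ) ⊗ₖ P) *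
      (((ρ x)ᵀ ⊗ₖ (1 : Matrix (Fin l) (Fin l) ℂ)) * K x)) = 0 := by
  have e : ∀ x, ((1 : Matrix (Fin (m x)) (Fin (m x)) ℂ) ⊗ₖ P) *
      (((ρ x)ᵀ ⊗ₖ (1 : Matrix (Fin l) (Fin l) ℂ)) * K x) = ((ρ x)ᵀ ⊗ₖ P) * K x := fun x => by
    rw [← mul_assoc, ← Matrix.mul_kronecker_mul, one_mul, mul_one]
  have hpsd : ∀ x, ((ρ x)ᵀ ⊗ₖ P).PosSemidef := fun x => (hρ x).transpose.kronecker hP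
  have ht : ∑ x, (p x : ℂ) * (((ρ x)ᵀ ⊗ₖ P) * K x).trace = 0 := by
    have := congrArg Matrix.trace h
    rw [Finset.mul_sum, Matrix.trace_sum, Matrix.trace_zero] at this
    rw [← this]
    refine Finset.sum_congr rfl fun x _ => ?_
    rw [Matrix.mul_smul, Matrix.trace_smul, ← partialTrace_one_kronecker_mul, trace_partialTrace,
      e, smul_eq_mul]
  -- Each summand is a nonnegative multiple of the trace of a product of two positive matrices, so a
  -- vanishing sum forces every summand to vanish.
  rw [Finset.sum_eq_zero_iff_of_nonneg fun x _ => mul_nonneg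
    (Complex.zero_le_real.mpr (hp x)) (trace_mul_nonneg (hpsd x) (hK x))] at ht
  rcases mul_eq_zero.mp (ht x (Finset.mem_univ x)) with h0 | h0
  · rw [h0, zero_smul]
  · rw [e, mul_eq_zero_of_trace_mul_eq_zero (hpsd x) (hK x) h0, smul_zero]

end Blocks

/-! ### What the Bayes condition prescribes on the support of `σ`. -/

section Compression

variable {k l : ℕ} {σ : Matrix (Fin l) (Fin l) ℂ}

/-- Multiplying the Bayes condition by the pseudoinverse of `σ` compresses the Choi matrix. -/
theorem smul_pinv_mul_eq (hσ : σ.IsHermitian) {p q : ℝ} (hq : q ≠ 0)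
    {C H : Matrix (Fin k × Fin l) (Fin k × Fin l) ℂ}
    (h : (q : ℂ) • (((1 : Matrix (Fin k) (Fin k) ℂ) ⊗ₖ σ) * C) = (p : ℂ) • H)
    (R : Matrix (Fin k × Fin l) (Fin k × Fin l) ℂ) :
    ((p / q : ℝ) : ℂ) • (((1 : Matrix (Fin k) (Fin k) ℂ) ⊗ₖ pinv σ) * H * R) =
      ((1 : Matrix (Fin k) (Fin k) ℂ) ⊗ₖ support σ) * C * R := by
  have hq' : (q : ℂ) ≠ 0 := by exact_mod_cast hq
  have e : ((p / q : ℝ) : ℂ) • H = ((1 : Matrix (Fin k) (Fin k) ℂ) ⊗ₖ σ) * C := by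
    rw [Complex.ofReal_div, div_eq_inv_mul, mul_smul, ← h, smul_smul, inv_mul_cancel₀ hq',
      one_smul]
  rw [← Matrix.smul_mul, ← Matrix.mul_smul, e, ← mul_assoc, one_kronecker_mul_one_kronecker,
    pinv_mul_self hσ]

theorem one_kronecker_one_sub (S : Matrix (Fin l) (Fin l) ℂ) :
    (1 : Matrix (Fin k) (Fin k) ℂ) ⊗ₖ (1 - S) = 1 - (1 : Matrix (Fin k) (Fin k) ℂ) ⊗ₖ S := by
  ext ⟨i, a⟩ ⟨j, b⟩
  by_cases h1 : i = j <;> by_cases h2 : a = b <;> simp [h1, h2]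

end Compression

/-! ### Positivity of `𝔄` and the range condition for `𝔅`. -/

section Extension

variable {ι : Type*} [Fintype ι] [DecidableEq ι] {T K Q : Matrix ι ι ℂ}

/-- Since `T * K * Q = T * (Q * K * Q)` is a product of two positive matrices, being Hermitian means
that they commute. -/
theorem mul_mul_posSemidef_of_isHermitian (hT : T.PosSemidef) (hK : K.PosSemidef)
    (hQ : Q.IsHermitian) (hTQ : T * Q = T) (hA : (T * K * Q).IsHermitian) :
    (T * K * Q).PosSemidef := by
  have e : T * K * Q = T * (Q * K * Q) := by rw [← mul_assoc, ← mul_assoc, hTQ]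
  have hP : (Q * K * Q).PosSemidef := by
    have := hK.conjTranspose_mul_mul_same Q
    rwa [hQ.eq] at this
  rw [e] at hA ⊢
  refine commute_mul_posSemidef hT hP ?_
  have h := hA.eq
  rw [Matrix.conjTranspose_mul, hT.1.eq, hP.1.eq] at h
  exact h.symm

/-- Let `M` be the projection off the range of `T * K * Q`. Then `M * T * K * Q = 0`, and `T = Q *
T` gives `(T * M)ᴴ * K * (T * M) = 0`. Positivity of `K` upgrades this to `M * T * K = 0`. -/
theorem mul_pinv_mul_mul_eq (hT : T.PosSemidef) (hK : K.PosSemidef)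
    (hQ : Q.IsHermitian) (hTQ : T * Q = T) (R : Matrix ι ι ℂ) :
    T * K * Q * pinv (T * K * Q) * (T * K * R) = T * K * R := by
  obtain ⟨k₁, -, k₃, -⟩ := pinv_spec (T * K * Q)
  set A := T * K * Q with hAdef
  set M := 1 - A * pinv A with hM
  have hMh : Mᴴ = M := by rw [hM, Matrix.conjTranspose_sub, k₃.eq, Matrix.conjTranspose_one]
  have hMA : M * A = 0 := by rw [hM, sub_mul, one_mul, k₁, sub_self]
  have hMT : M * T * K * Q = 0 := by rw [← hMA, hAdef]; simp only [mul_assoc]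
  have hQT : Q * T = T := by
    simpa [Matrix.conjTranspose_mul, hQ.eq, hT.1.eq] using congrArg Matrix.conjTranspose hTQ
  have h0 : (T * M)ᴴ * K * (T * M) = 0 := by
    calc (T * M)ᴴ * K * (T * M) = M * T * K * (Q * T) * M := by
          rw [Matrix.conjTranspose_mul, hMh, hT.1.eq, hQT]; simp only [mul_assoc]
      _ = M * T * K * Q * (T * M) := by simp only [mul_assoc]
      _ = 0 := by rw [hMT, zero_mul]
  have h1 : M * T * K = 0 := by
    have := congrArg Matrix.conjTranspose (mul_eq_zero_of_conjTranspose_mul_mul_eq_zero hK h0)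
    simpa [Matrix.conjTranspose_mul, hMh, hT.1.eq, hK.1.eq, mul_assoc] using this
  have h2 : M * (T * K * R) = 0 := by rw [← mul_assoc, ← mul_assoc, h1, zero_mul]
  rw [hM, sub_mul, one_mul, sub_eq_zero] at h2
  exact h2.symm

end Extension

/-! ### Construction of the inverse at a fixed `y` with `q > 0`. -/

section Component

variable {X : Type*} [Fintype X] {m : X → ℕ} {l : ℕ}

/-- The converse direction at one `y`: `K x` plays the Choi matrix of `F_xy⋆` and `C x` that of the
sought `G_yx`. The marginal hypothesis `hmarg` encodes `ξ = ω ∘ F`. -/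
theorem exists_choi_of_isHermitian_of_le {p : X → ℝ} (hp : ∀ x, 0 ≤ p x) {ρ : BlockAlg m}
    (hρ : ∀ x, IsDensityMatrix (ρ x)) (hp1 : ∑ x, p x = 1) {q : ℝ} (hq : 0 < q)
    {σ : Matrix (Fin l) (Fin l) ℂ} (hσ : σ.PosSemidef)
    {K : ∀ x, Matrix (Fin (m x) × Fin l) (Fin (m x) × Fin l) ℂ} (hK : ∀ x, (K x).PosSemidef)
    (hmarg : ∑ x, (p x : ℂ) •
      partialTrace (((ρ x)ᵀ ⊗ₖ (1 : Matrix (Fin l) (Fin l) ℂ)) * K x) = (q : ℂ) • σ)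
    {A B : ∀ x, Matrix (Fin (m x) × Fin l) (Fin (m x) × Fin l) ℂ}
    (hAdef : ∀ x, A x = ((p x / q : ℝ) : ℂ) • (((1 : Matrix (Fin (m x)) (Fin (m x)) ℂ) ⊗ₖ pinv σ) *
      (((ρ x)ᵀ ⊗ₖ (1 : Matrix (Fin l) (Fin l) ℂ)) * K x) *
      ((1 : Matrix (Fin (m x)) (Fin (m x)) ℂ) ⊗ₖ support σ)))
    (hBdef : ∀ x, B x = ((p x / q : ℝ) : ℂ) • (((1 : Matrix (Fin (m x)) (Fin (m x)) ℂ) ⊗ₖ pinv σ) *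
      (((ρ x)ᵀ ⊗ₖ (1 : Matrix (Fin l) (Fin l) ℂ)) * K x) *
      ((1 : Matrix (Fin (m x)) (Fin (m x)) ℂ) ⊗ₖ (1 - support σ))))
    (hA : ∀ x, (A x)ᴴ = A x)
    (hle : ∑ x, partialTrace ((B x)ᴴ * pinv (A x) * B x) ≤ 1 - support σ) :
    ∃ C : ∀ x, Matrix (Fin (m x) × Fin l) (Fin (m x) × Fin l) ℂ,
      (∀ x, (C x).PosSemidef) ∧ ∑ x, partialTrace (C x) = 1 ∧
      ∀ x, (q : ℂ) • (((1 : Matrix (Fin (m x)) (Fin (m x)) ℂ) ⊗ₖ σ) * C x) =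
        (p x : ℂ) • (((ρ x)ᵀ ⊗ₖ (1 : Matrix (Fin l) (Fin l) ℂ)) * K x) := by
  have hq' : (q : ℂ) ≠ 0 := by exact_mod_cast hq.ne'
  set Q := support σ with hQdef
  have hQh : Qᴴ = Q := support_isHermitian σ
  have hQQ : Q * Q = Q := support_mul_support σ
  have hQP : Q * (1 - Q) = 0 := by rw [mul_sub, mul_one, hQQ, sub_self]
  have hσσ : pinv σ * σ = Q := pinv_mul_self hσ.1
  have hQσ : Q * pinv σ = pinv σ := mul_pinv_of_mul_eq hσ.1 (support_mul_self σ)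
  have hσQ : pinv σ * Q = pinv σ := pinv_mul_of_mul_eq hσ.1 (self_mul_support hσ.1)
  have hsupp := smul_kronecker_mul_eq_zero hp (fun x => (hρ x).posSemidef) hK
    (one_sub_support_posSemidef σ)
    (by rw [hmarg, Matrix.mul_smul, sub_mul, one_mul, support_mul_self, sub_self, smul_zero])
  let Q' : ∀ x, Matrix (Fin (m x) × Fin l) (Fin (m x) × Fin l) ℂ := fun x =>
    (1 : Matrix (Fin (m x)) (Fin (m x)) ℂ) ⊗ₖ Q
  have hQ'h : ∀ x, (Q' x).IsHermitian := fun x => by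
    simp only [Q', Matrix.IsHermitian, conjTranspose_one_kronecker, hQh]
  -- `T` merges the two left factors and `L` absorbs the scalar, so that `A = T * L * Q'` and `B = T
  -- * L * (1 - Q')`, the shape treated by the extension lemmas.
  let T : ∀ x, Matrix (Fin (m x) × Fin l) (Fin (m x) × Fin l) ℂ := fun x => (ρ x)ᵀ ⊗ₖ pinv σ
  let L : ∀ x, Matrix (Fin (m x) × Fin l) (Fin (m x) × Fin l) ℂ := fun x =>
    ((p x / q : ℝ) : ℂ) • K x
  have hT : ∀ x, (T x).PosSemidef := fun x =>
    (hρ x).posSemidef.transpose.kronecker (pinv_posSemidef hσ)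
  have hL : ∀ x, (L x).PosSemidef := fun x =>
    (hK x).smul (Complex.zero_le_real.mpr (div_nonneg (hp x) hq.le))
  have hTQ : ∀ x, T x * Q' x = T x := fun x => by
    simp only [T, Q', ← Matrix.mul_kronecker_mul, mul_one, hσQ]
  have hQT : ∀ x, Q' x * T x = T x := fun x => by
    simp only [T, Q', ← Matrix.mul_kronecker_mul, one_mul, hQσ]
  have eT : ∀ x (R : Matrix (Fin (m x) × Fin l) (Fin (m x) × Fin l) ℂ),
      ((p x / q : ℝ) : ℂ) • (((1 : Matrix (Fin (m x)) (Fin (m x)) ℂ) ⊗ₖ pinv σ) *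
        (((ρ x)ᵀ ⊗ₖ (1 : Matrix (Fin l) (Fin l) ℂ)) * K x) * R) = T x * L x * R := fun x R => by
    simp only [T, L]
    rw [← mul_assoc (_ ⊗ₖ _), ← Matrix.mul_kronecker_mul, one_mul, mul_one, Matrix.mul_smul,
      Matrix.smul_mul]
  have eA : ∀ x, A x = T x * L x * Q' x := fun x => by rw [hAdef, eT]
  have eB : ∀ x, B x = T x * L x * (1 - Q' x) := fun x => by
    rw [hBdef, eT, one_kronecker_one_sub]
  have hApsd : ∀ x, (A x).PosSemidef := fun x => by
    have h : (A x).IsHermitian := hA x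
    rw [eA] at h ⊢
    exact mul_mul_posSemidef_of_isHermitian (hT x) (hL x) (hQ'h x) (hTQ x) h
  have hAB : ∀ x, A x * pinv (A x) * B x = B x := fun x => by
    rw [eB, eA]
    exact mul_pinv_mul_mul_eq (hT x) (hL x) (hQ'h x) (hTQ x) _
  have hQA : ∀ x, Q' x * A x = A x := fun x => by rw [eA, ← mul_assoc, ← mul_assoc, hQT]
  have hQB : ∀ x, Q' x * B x = B x := fun x => by rw [eB, ← mul_assoc, ← mul_assoc, hQT]
  have hBQ : ∀ x, B x * ((1 : Matrix (Fin (m x)) (Fin (m x)) ℂ) ⊗ₖ (1 - Q)) = B x := fun x => by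
    have : (1 - Q) * (1 - Q) = 1 - Q := by rw [sub_mul, hQP, one_mul, sub_zero]
    rw [hBdef, Matrix.smul_mul, mul_assoc, one_kronecker_mul_one_kronecker, this]
  have hQBh : ∀ x, Q' x * (B x)ᴴ = 0 := fun x => by
    rw [← hBQ x, Matrix.conjTranspose_mul, conjTranspose_one_kronecker, ← mul_assoc]
    simp only [Q']
    rw [one_kronecker_mul_one_kronecker, Matrix.conjTranspose_sub, hQh, Matrix.conjTranspose_one,
      hQP, Matrix.kronecker_zero, zero_mul]
  set S := ∑ x, partialTrace ((B x)ᴴ * pinv (A x) * B x) with hS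
  have hQS : Q * S = 0 := by
    rw [hS, Finset.mul_sum]
    refine Finset.sum_eq_zero fun x _ => ?_
    rw [← partialTrace_one_kronecker_mul, ← mul_assoc, ← mul_assoc]
    change partialTrace (Q' x * (B x)ᴴ * pinv (A x) * B x) = 0
    rw [hQBh, zero_mul, zero_mul]
    ext a b; simp [partialTrace]
  have hQR : Q * (1 - Q - S) = 0 := by rw [mul_sub, hQP, hQS, sub_zero]
  have hR : (1 - Q - S).PosSemidef := hle
  have hsum : ∑ x, partialTrace (T x * L x) = Q := by
    have h : ∀ x, partialTrace (T x * L x) = ((q : ℂ)⁻¹) • (pinv σ * ((p x : ℂ) •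
        partialTrace (((ρ x)ᵀ ⊗ₖ (1 : Matrix (Fin l) (Fin l) ℂ)) * K x))) := fun x => by
      have := eT x 1
      rw [mul_one, mul_one] at this
      rw [← this, partialTrace_smul, partialTrace_one_kronecker_mul, Matrix.mul_smul, smul_smul,
        Complex.ofReal_div, div_eq_inv_mul]
    simp only [h]
    rw [← Finset.smul_sum, ← Finset.mul_sum, hmarg, Matrix.mul_smul, smul_smul,
      inv_mul_cancel₀ hq', one_smul, hσσ]
  have eAB : ∀ x, A x + B x = T x * L x := fun x => by
    rw [eA, eB, mul_sub, mul_one, add_sub_cancel]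
  -- The partial traces of `T x * L x` sum to `Q`, so those of `B x` sum to `Q * (1 - Q)`: the
  -- off-diagonal parts do not disturb unitality.
  have hsumB : ∑ x, partialTrace (B x) = 0 := by
    have h : ∀ x, partialTrace (B x) = partialTrace (T x * L x) * (1 - Q) := fun x => by
      rw [← partialTrace_mul_one_kronecker, eB, one_kronecker_one_sub]
    simp only [h]
    rw [← Finset.sum_mul, hsum, hQP]
  -- The first four terms have total partial trace `Q + S`. The slack `1 - Q - S` is spread over `x`
  -- with weights `p x • (ρ x)ᵀ` of total trace one, and `Q` annihilates it.
  refine ⟨fun x => A x + B x + (B x)ᴴ + (B x)ᴴ * pinv (A x) * B x +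
    (p x : ℂ) • ((ρ x)ᵀ ⊗ₖ (1 - Q - S)), fun x => ?_, ?_, fun x => ?_⟩
  · exact (schur_extension_posSemidef (hApsd x) (hQ'h x) (hQA x) (hQB x) (hAB x)).add
      (((hρ x).posSemidef.transpose.kronecker hR).smul (Complex.zero_le_real.mpr (hp x)))
  · have hlast : ∑ x, partialTrace ((p x : ℂ) • ((ρ x)ᵀ ⊗ₖ (1 - Q - S))) = 1 - Q - S := by
      simp only [partialTrace_smul, partialTrace_kronecker, Matrix.trace_transpose,
        (hρ _).trace_eq_one, one_smul]
      rw [← Finset.sum_smul, ← Complex.ofReal_sum, hp1, Complex.ofReal_one, one_smul]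
    simp only [eAB, partialTrace_add, Finset.sum_add_distrib, partialTrace_conjTranspose]
    rw [← Matrix.conjTranspose_sum, hsumB, hsum, hlast, ← hS, Matrix.conjTranspose_zero]
    abel
  · have e1 : Q' x * (A x + B x + (B x)ᴴ + (B x)ᴴ * pinv (A x) * B x +
        (p x : ℂ) • ((ρ x)ᵀ ⊗ₖ (1 - Q - S))) = T x * L x := by
      have e : Q' x * ((ρ x)ᵀ ⊗ₖ (1 - Q - S)) = 0 := by
        simp only [Q']
        rw [← Matrix.mul_kronecker_mul, hQR, Matrix.kronecker_zero]
      rw [mul_add, mul_add, mul_add, ← mul_assoc, ← mul_assoc, hQBh, Matrix.mul_smul, e,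
        eAB, ← mul_assoc, hQT]
      simp
    have e2 : (1 : Matrix (Fin (m x)) (Fin (m x)) ℂ) ⊗ₖ σ =
        ((1 : Matrix (Fin (m x)) (Fin (m x)) ℂ) ⊗ₖ σ) * Q' x := by
      simp only [Q']
      rw [one_kronecker_mul_one_kronecker, self_mul_support hσ.1]
    -- The right-hand side has no component off the support of `σ`, so the projection left by `σ *
    -- pinv σ` can be dropped.
    have e3 := hsupp x
    rw [one_kronecker_one_sub, sub_mul, one_mul, smul_sub, sub_eq_zero] at e3
    have e4 := eT x 1
    rw [mul_one, mul_one] at e4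
    rw [e2, mul_assoc, e1, ← e4, Matrix.mul_smul, smul_smul, ← mul_assoc,
      one_kronecker_mul_one_kronecker, ← support_eq_mul_pinv, e3, Complex.ofReal_div,
      mul_div_cancel₀ _ hq']

end Component

end QBayes

/-! ### The equivalence. -/

theorem mainTheorem2 {X Y : Type*} [Fintype X] [Fintype Y] [DecidableEq Y]
    (m : X → ℕ) (n : Y → ℕ)
    (F : BlockAlg n →CP BlockAlg m) (hF : F 1 = 1)
    (ω : BlockAlg m →ₚ[ℂ] ℂ) (hω : ω 1 = 1)
    (p : X → ℝ) (ρ : BlockAlg m) (hpρ : IsBlockDecomposition (fun a => ω a) p ρ)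
    (q : Y → ℝ) (σ : BlockAlg n) (hqσ : IsBlockDecomposition (fun b => ω (F b)) q σ) :
    (∃ G : BlockAlg m →CP BlockAlg n, IsBayesianInverse F ω G) ↔
      (∀ (x : X) (y : Y), q y ≠ 0 →
        (matA F.toLinearMap p ρ q σ y x)ᴴ = matA F.toLinearMap p ρ q σ y x) ∧
      (∀ y : Y, q y ≠ 0 →
        ∑ x, partialTrace ((matB F.toLinearMap p ρ q σ y x)ᴴ *
            pinv (matA F.toLinearMap p ρ q σ y x) * matB F.toLinearMap p ρ q σ y x) ≤
          1 - support (σ y)) := by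
  classical
  have hK : ∀ x y, (choi (hsDual (blockMap F.toLinearMap x y))).PosSemidef := fun x y =>
    choi_hsDual_posSemidef (choi_blockMap_posSemidef F x y)
  have hmarg : ∀ y, ∑ x, (p x : ℂ) •
      partialTrace (((ρ x)ᵀ ⊗ₖ (1 : Matrix (Fin (n y)) (Fin (n y)) ℂ)) *
        choi (hsDual (blockMap F.toLinearMap x y))) = (q y : ℂ) • σ y := fun y => by
    simp only [← hsDual_apply_eq_partialTrace]
    exact sum_smul_hsDual_eq hpρ hqσ y
  constructor
  · rintro ⟨G, hG1, hG⟩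
    rw [bayes_iff_choi hpρ hqσ] at hG
    have hC : ∀ y x, (choi (blockMap G.toLinearMap y x)).PosSemidef := fun y x =>
      choi_blockMap_posSemidef G y x
    have hA : ∀ x y, q y ≠ 0 → matA F.toLinearMap p ρ q σ y x =
        ((1 : Matrix (Fin (m x)) (Fin (m x)) ℂ) ⊗ₖ support (σ y)) *
          choi (blockMap G.toLinearMap y x) *
          ((1 : Matrix (Fin (m x)) (Fin (m x)) ℂ) ⊗ₖ support (σ y)) := fun x y hq => by
      rw [matA, bayesChoi_eq, smul_pinv_mul_eq (hqσ.density y).posSemidef.1 hq (hG x y)]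
    have hB : ∀ x y, q y ≠ 0 → matB F.toLinearMap p ρ q σ y x =
        ((1 : Matrix (Fin (m x)) (Fin (m x)) ℂ) ⊗ₖ support (σ y)) *
          choi (blockMap G.toLinearMap y x) *
          (1 - (1 : Matrix (Fin (m x)) (Fin (m x)) ℂ) ⊗ₖ support (σ y)) := fun x y hq => by
      rw [matB, bayesChoi_eq, smul_pinv_mul_eq (hqσ.density y).posSemidef.1 hq (hG x y),
        one_kronecker_one_sub]
    have hQh : ∀ x y, ((1 : Matrix (Fin (m x)) (Fin (m x)) ℂ) ⊗ₖ support (σ y)).IsHermitian :=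
      fun x y => by
        rw [Matrix.IsHermitian, conjTranspose_one_kronecker, (support_isHermitian (σ y)).eq]
    refine ⟨fun x y hq => ?_, fun y hq => ?_⟩
    · rw [hA x y hq]
      simp only [Matrix.conjTranspose_mul, (hQh x y).eq, (hC y x).1.eq, mul_assoc]
    · have hG1y : ∑ x, partialTrace (choi (blockMap G.toLinearMap y x)) = 1 := by
        simp only [← apply_one_eq_partialTrace]
        have h : G 1 y = ∑ x, blockMap G.toLinearMap y x ((1 : BlockAlg m) x) :=
          apply_eq_sum_blockMap G.toLinearMap 1 y
        rw [hG1] at h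
        exact h.symm
      -- Summing the partial traces of the Schur complements, unitality of `G` turns the corner
      -- terms into `(1 - Q) * (1 - Q) = 1 - Q`.
      have h := Matrix.posSemidef_sum Finset.univ fun x _ => partialTrace_posSemidef
        (schur_complement_posSemidef (hC y x) (hQh x y)
          (by rw [one_kronecker_mul_one_kronecker, support_mul_support]))
      rw [← sub_nonneg]
      convert h.nonneg using 1
      simp only [partialTrace_sub, Finset.sum_sub_distrib, hA _ y hq, hB _ y hq]
      congr 1
      simp only [← one_kronecker_one_sub, partialTrace_mul_one_kronecker,
        partialTrace_one_kronecker_mul]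
      rw [← Finset.sum_mul, ← Finset.mul_sum, hG1y, mul_one]
      exact (support_spec (σ y)).1.one_sub.isIdempotentElem.symm
  · rintro ⟨hA, hle⟩
    have hex : ∀ y, ∃ C : ∀ x, Matrix (Fin (m x) × Fin (n y)) (Fin (m x) × Fin (n y)) ℂ,
        (∀ x, (C x).PosSemidef) ∧ ∑ x, partialTrace (C x) = 1 ∧
        ∀ x, (q y : ℂ) • (((1 : Matrix (Fin (m x)) (Fin (m x)) ℂ) ⊗ₖ σ y) * C x) =
          (p x : ℂ) • (((ρ x)ᵀ ⊗ₖ (1 : Matrix (Fin (n y)) (Fin (n y)) ℂ)) *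
            choi (hsDual (blockMap F.toLinearMap x y))) := fun y => by
      by_cases hq : q y = 0
      -- These are the Choi matrices of `a ↦ ω(a) 1`. Any positive unital choice would do, since
      -- both sides of the Bayes condition vanish here: the marginal is zero, so
      -- `smul_kronecker_mul_eq_zero` applies with `P = 1`.
      · refine ⟨fun x => (p x : ℂ) • ((ρ x)ᵀ ⊗ₖ 1), fun x => ?_, ?_, fun x => ?_⟩
        · exact ((hpρ.density x).posSemidef.transpose.kronecker Matrix.PosSemidef.one).smul
            (Complex.zero_le_real.mpr (hpρ.nonneg x))
        · simp only [partialTrace_smul, partialTrace_kronecker, Matrix.trace_transpose,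
            (hpρ.density _).trace_eq_one, one_smul]
          rw [← Finset.sum_smul, ← Complex.ofReal_sum, hpρ.sum_eq_one, Complex.ofReal_one,
            one_smul]
        · have h := smul_kronecker_mul_eq_zero hpρ.nonneg
            (fun x => (hpρ.density x).posSemidef) (fun x => hK x y) Matrix.PosSemidef.one
            (by rw [hmarg, hq, Complex.ofReal_zero, zero_smul, mul_zero]) x
          rw [Matrix.one_kronecker_one, one_mul] at h
          rw [h, hq, Complex.ofReal_zero, zero_smul]
      · exact exists_choi_of_isHermitian_of_le hpρ.nonneg hpρ.density hpρ.sum_eq_one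
          (lt_of_le_of_ne (hqσ.nonneg y) (Ne.symm hq)) (hqσ.density y).posSemidef
          (fun x => hK x y) (hmarg y) (fun x => bayesChoi_eq _ _ _ _ _ _)
          (fun x => bayesChoi_eq _ _ _ _ _ _) (fun x => hA x y hq) (hle y hq)
    choose C hCpsd hC1 hCbayes using hex
    have hblock : ∀ y x, blockMap (cpOfChoi C hCpsd).toLinearMap y x = ofChoi (C y x) :=
      fun y x => by
        refine LinearMap.ext fun a => ?_
        change blockOfChoi C (Pi.single x a) y = _
        rw [blockOfChoi_apply, Finset.sum_eq_single x (fun z _ hz => by simp [hz]) (by simp),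
          Pi.single_eq_same]
    refine ⟨cpOfChoi C hCpsd, ?_, ?_⟩
    · funext y
      change blockOfChoi C 1 y = 1
      rw [blockOfChoi_apply, ← hC1 y]
      exact Finset.sum_congr rfl fun x _ => ofChoi_one _
    · rw [bayes_iff_choi hpρ hqσ]
      intro x y
      rw [hblock, choi_ofChoi]
      exact hCbayes y x
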